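/- Let $d\ge 2$ and write $\hat f(\xi)=\int f(x)e^{-2\pi i\langle x,\xi\rangle}dx$. \emph{Classical spaces.} Let $\Phi,\varphi\in\mathcal S(\mathbb R^d)$ with $\operatorname{supp}\hat\varphi\subseteq\{\frac12\le|\xi|\le2\}$, $\operatorname{supp}\hat\Phi\subseteq\{|\xi|\le2\}$, and, for some $c>0$, $|\hat\varphi|\ge c$ on $\{\frac35\le|\xi|\le\frac53\}$ and $|\hat\Phi|\ge c$ on $\{|\xi|\le\frac53\}$. Put $\varphi_{2^\nu I}(x)=2^{d\nu}\varphi(2^\nu x)$. For $\alpha\in\mathbb R$, $0<p<\infty$, $0<q\le\infty$ and $f\in\mathcal S'(\mathbb R^d)$ let $$\|f\|_{\mathbf F^{\alpha,q}_p}=\|\Phi*f\|_{L^p}+\Big\|\Big(\sum_{\nu\ge0}(2^{\nu\alpha}|\varphi_{2^\nu I}*f|)^q\Big)^{1/q}\Big\|_{L^p}$$ (a supremum over $\nu$ if $q=\infty$). \emph{Shear anisotropic spaces.} Let $\hat\psi_1,\hat\psi_2\in C^\infty(\mathbb R)$ with $\operatorname{supp}\hat\psi_1\subseteq[-\frac12,-\frac1{16}]\cup[\frac1{16},\frac12]$,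 $\operatorname{supp}\hat\psi_2\subseteq[-1,1]$, $\sum_{j\ge0}|\hat\psi_1(2^{-2j}\omega)|^2=1$ for $|\omega|\ge\frac18$, and $|\hat\psi_2(\omega-1)|^2+|\hat\psi_2(\omega)|^2+|\hat\psi_2(\omega+1)|^2=1$ for $|\omega|\le1$. For $\mathfrak d=1,\dots,d$ let $\psi^{(\mathfrak d)}\in\mathcal S(\mathbb R^d)$ be given by $\hat\psi^{(\mathfrak d)}(\xi)=\hat\psi_1(\xi_{\mathfrak d})\prod_{i\ne\mathfrak d}\hat\psi_2(\xi_i/\xi_{\mathfrak d})$. Let $A_{(\mathfrak d)}$ be the diagonal matrix with entry $4$ in position $\mathfrak d$ and $2$ elsewhere, and for $\ell=(\ell_i)_{i\ne\mathfrak d}\in\mathbb Z^{d-1}$ let $B^{[\ell]}_{(\mathfrak d)}$ be the identity matrix with the entries $\ell_i$ put in the off-diagonal positions of row $\mathfrak d$. Write $|[\ell]|\preceq2^j$ if $|\ell_i|\le 2^j$ for all $i$. Let $\Psi\in\mathcal S(\mathbb R^d)$ with $\operatorname{supp}\hat\Psi\subseteq[-\frac14,\frac14]^d$ and $|\hat\Psi|=1$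 on $\mathcal R=[-\frac18,\frac18]^d$, such that the Parseval frame condition $$|\hat\Psi(\xi)|^2\chi_{\mathcal R}(\xi)+\sum_{\mathfrak d=1}^d\sum_{j\ge0}\sum_{|[\ell]|\preceq2^j}|\hat\psi^{(\mathfrak d)}(\xi A_{(\mathfrak d)}^{-j}B_{(\mathfrak d)}^{[-\ell]})|^2\chi_{\mathcal D^{(\mathfrak d)}}(\xi)=1$$ holds for almost every $\xi$, where $\mathcal D^{(\mathfrak d)}=\{|\xi_{\mathfrak d}|\ge\frac18,\ |\xi_i/\xi_{\mathfrak d}|\le1\ (i\ne\mathfrak d)\}$. Put $|Q_j|=2^{-(d+1)j}$, $g_M(x)=|\det M|^{-1}g(M^{-1}x)$ for invertible $M$, and $\tilde g(x)=\overline{g(-x)}$. For $\alpha\in\mathbb R$, $0<p<\infty$, $0<q\le\infty$ and $f\in\mathcal S'(\mathbb R^d)$ let $$\|f\|_{\mathbf F^{\alpha,q}_p(AB)}=\|f*\Psi\|_{L^p}+\Big\|\Big(\sum_{\mathfrak d=1}^d\sum_{j\ge0}\sum_{|[\ell]|\preceq2^j}\big[|Q_j|^{-\alpha}|\tilde\psi^{(\mathfrak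 d)}_{A^{-j}_{(\mathfrak d)}B^{[-\ell]}_{(\mathfrak d)}}*f|\big]^q\Big)^{1/q}\Big\|_{L^p}$$ (a supremum if $q=\infty$). Finally let $\psi_{j,0,0}(x)=|\det A_{(1)}|^{j/2}\psi^{(1)}(A_{(1)}^jx)$. \textbf{Theorem.} Let $\alpha_1,\alpha_2\in\mathbb R$, $0<q_1,q_2\le\infty$ and $0<p_1,p_2<\infty$ satisfy $$2(\alpha_1+d)<(d+1)\Big(\alpha_2-\frac1{p_2}+1\Big)+\frac d{p_1}.$$ Then there is a sequence of functions $\{f^{(j)}\}_{j\ge0}$, each $f^{(j)}$ a scalar multiple of $\psi_{j,0,0}$, and there are constants $0<c\le C<\infty$ such that $c\le\|f^{(j)}\|_{\mathbf F^{\alpha_2,q_2}_{p_2}(AB)}\le C$ for all $j\ge0$, while, for every choice of $(\Phi,\varphi)$ as above, $\|f^{(j)}\|_{\mathbf F^{\alpha_1,q_1}_{p_1}}\to0$ as $j\to\infty$. -/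

import Mathlib

open MeasureTheory Filter Topology
open scoped SchwartzMap FourierTransform ENNReal

namespace ShearTL

/-- `ℝ^d` with the Euclidean norm and Lebesgue measure. -/
abbrev E (d : ℕ) : Type := EuclideanSpace ℝ (Fin d)

noncomputable section

/-! ### Operations on Schwartz functions and tempered distributions -/

/-- The linear automorphism `x ↦ M x` of `ℝ^d` given by an invertible matrix. -/
def glEquiv {d : ℕ} (M : GL (Fin d) ℝ) : E d ≃L[ℝ] E d :=
  ContinuousLinearEquiv.unitsEquiv ℝ (E d)
    (Units.map (Matrix.toEuclideanCLM (n := Fin d) (𝕜 := ℝ) :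
      Matrix (Fin d) (Fin d) ℝ →* (E d →L[ℝ] E d)) M)

theorem glEquiv_apply {d : ℕ} (M : GL (Fin d) ℝ) (x : E d) :
    glEquiv M x = WithLp.toLp 2 (Matrix.mulVec (M : Matrix (Fin d) (Fin d) ℝ) x.ofLp) := rfl

/-- The anisotropic dilation `ψ_M(x) = |det M|⁻¹ ψ(M⁻¹ x)`. -/
def dilate {d : ℕ} (M : GL (Fin d) ℝ) (ψ : 𝓢(E d, ℂ)) : 𝓢(E d, ℂ) :=
  ((|(M : Matrix (Fin d) (Fin d) ℝ).det|⁻¹ : ℝ) : ℂ) •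
    SchwartzMap.compCLMOfContinuousLinearEquiv ℂ (glEquiv M⁻¹) ψ

/-- The dyadic dilation `x ↦ 2^{dν} φ(2^ν x)`. -/
def dyadicDilate {d : ℕ} (ν : ℕ) (φ : 𝓢(E d, ℂ)) : 𝓢(E d, ℂ) :=
  ((2 : ℂ) ^ (d * ν)) •
    SchwartzMap.compCLMOfContinuousLinearEquiv ℂ
      (ContinuousLinearEquiv.smulLeft (R₁ := ℝ) (M₁ := E d)
        (Units.mk0 ((2 : ℝ) ^ ν) (by positivity))) φ

/-- The reflection `x ↦ g(-x)`. -/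
def reflect {d : ℕ} (g : 𝓢(E d, ℂ)) : 𝓢(E d, ℂ) :=
  SchwartzMap.compCLMOfContinuousLinearEquiv ℂ (ContinuousLinearEquiv.neg ℝ (M := E d)) g

/-- `x ↦ conj (ψ(-x))`. -/
def tilde {d : ℕ} (ψ : 𝓢(E d, ℂ)) : 𝓢(E d, ℂ) :=
  SchwartzMap.postcompCLM (𝕜 := ℝ) (Complex.conjCLE : ℂ →L[ℝ] ℂ) (reflect ψ)

/-- The convolution of a tempered distribution with a Schwartz function, as a function:
`(f ∗ g)(x) = ⟨f, g(x - ·)⟩`. -/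
def conv {d : ℕ} (f : 𝓢'(E d, ℂ)) (g : 𝓢(E d, ℂ)) (x : E d) : ℂ :=
  f (SchwartzMap.compSubConstCLM ℂ x (reflect g))

theorem dilate_apply {d : ℕ} (M : GL (Fin d) ℝ) (ψ : 𝓢(E d, ℂ)) (x : E d) :
    dilate M ψ x = ((|(M : Matrix (Fin d) (Fin d) ℝ).det|⁻¹ : ℝ) : ℂ) * ψ (glEquiv M⁻¹ x) := rfl

theorem dyadicDilate_apply {d : ℕ} (ν : ℕ) (φ : 𝓢(E d, ℂ)) (x : E d) :
    dyadicDilate ν φ x = (2 : ℂ) ^ (d * ν) * φ (((2 : ℝ) ^ ν) • x) := rfl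

theorem tilde_apply {d : ℕ} (ψ : 𝓢(E d, ℂ)) (x : E d) :
    tilde ψ x = (starRingEnd ℂ) (ψ (-x)) := rfl

/-- For a Schwartz function `f`, `conv f g` is the usual convolution. -/
theorem conv_coe {d : ℕ} (f g : 𝓢(E d, ℂ)) (x : E d) :
    conv (f : 𝓢'(E d, ℂ)) g x = ∫ y, f y * g (x - y) := by
  rw [conv, SchwartzMap.coe_apply]
  refine integral_congr_ae (Eventually.of_forall fun y => ?_)
  have h : (SchwartzMap.compSubConstCLM ℂ x (reflect g)) y = g (-(y - x)) := rfl
  simp only [h, neg_sub, smul_eq_mul]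
  ring

/-! ### Mixed quasi-norms -/

/-- The `ℓ^q` quasi-norm, `0 < q ≤ ∞`, of a family in `[0,∞]`. -/
def lq {ι : Type*} (q : ℝ≥0∞) (a : ι → ℝ≥0∞) : ℝ≥0∞ :=
  if q = ∞ then ⨆ i, a i else (∑' i, a i ^ q.toReal) ^ (1 / q.toReal)

/-- The `L^p(ℝ^d)` quasi-norm, `0 < p < ∞`, of a function with values in `[0,∞]`. -/
def lpNorm {d : ℕ} (p : ℝ) (F : E d → ℝ≥0∞) : ℝ≥0∞ :=
  (∫⁻ x, F x ^ p) ^ (1 / p)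

/-! ### Classical inhomogeneous Triebel–Lizorkin spaces -/

/-- Admissible pairs `(Φ, φ)` of functions defining the classical dyadic spaces. -/
structure DyadicSystem (d : ℕ) where
  Phi : 𝓢(E d, ℂ)
  phi : 𝓢(E d, ℂ)
  supp_phi : tsupport (𝓕 phi : 𝓢(E d, ℂ)) ⊆ {ξ | 1 / 2 ≤ ‖ξ‖ ∧ ‖ξ‖ ≤ 2}
  supp_Phi : tsupport (𝓕 Phi : 𝓢(E d, ℂ)) ⊆ {ξ | ‖ξ‖ ≤ 2}
  lower_phi : ∃ c : ℝ, 0 < c ∧ ∀ ξ : E d, 3 / 5 ≤ ‖ξ‖ → ‖ξ‖ ≤ 5 / 3 → c ≤ ‖𝓕 phi ξ‖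
  lower_Phi : ∃ c : ℝ, 0 < c ∧ ∀ ξ : E d, ‖ξ‖ ≤ 5 / 3 → c ≤ ‖𝓕 Phi ξ‖

/-- The classical quasi-norm of `F^{α,q}_p`:
`‖Φ ∗ f‖_{L^p} + ‖(∑_{ν ≥ 0} (2^{να} |φ_{2^ν I} ∗ f|)^q)^{1/q}‖_{L^p}`. -/
def DyadicSystem.normF {d : ℕ} (D : DyadicSystem d) (α p : ℝ) (q : ℝ≥0∞)
    (f : 𝓢'(E d, ℂ)) : ℝ≥0∞ :=
  lpNorm p (fun x => ‖conv f D.Phi x‖ₑ) +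
    lpNorm p (fun x => lq q (fun ν : ℕ =>
      ENNReal.ofReal ((2 : ℝ) ^ ((ν : ℝ) * α)) * ‖conv f (dyadicDilate ν D.phi) x‖ₑ))

/-! ### Shearlets on the cones -/

/-- The diagonal matrix `A_(𝔡)`, with entry `4` at position `𝔡` and `2` elsewhere. -/
def matA {d : ℕ} (𝔡 : Fin d) : GL (Fin d) ℝ :=
  Matrix.GeneralLinearGroup.mkOfDetNeZero
    (Matrix.diagonal fun i => if i = 𝔡 then (4 : ℝ) else 2) (by
      rw [Matrix.det_diagonal]
      exact Finset.prod_ne_zero_iff.2 fun i _ => by split_ifs <;> norm_num)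

/-- The entries of the shear matrix `B_(𝔡)^{[ℓ]}`: ones on the diagonal, and the shear
parameters `ℓ` in the off-diagonal positions of row `𝔡`. -/
def shearMatrix {d : ℕ} (𝔡 : Fin d) (ℓ : {i : Fin d // i ≠ 𝔡} → ℤ) :
    Matrix (Fin d) (Fin d) ℝ :=
  Matrix.of fun i k =>
    if i = 𝔡 then (if h : k ≠ 𝔡 then (ℓ ⟨k, h⟩ : ℝ) else 1) else if i = k then 1 else 0

theorem shearMatrix_mul_neg {d : ℕ} (𝔡 : Fin d) (ℓ : {i : Fin d // i ≠ 𝔡} → ℤ) :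
    shearMatrix 𝔡 ℓ * shearMatrix 𝔡 (-ℓ) = 1 := by
  ext i m
  rw [Matrix.mul_apply]
  by_cases hi : i = 𝔡
  · subst hi
    rw [← Finset.add_sum_erase _ _ (Finset.mem_univ i)]
    by_cases hm : m = i
    · subst hm
      rw [Finset.sum_eq_zero]
      · simp [shearMatrix]
      · intro k hk
        have hk' : k ≠ m := Finset.ne_of_mem_erase hk
        simp [shearMatrix, hk']
    · rw [Finset.sum_eq_single_of_mem m (Finset.mem_erase.2 ⟨hm, Finset.mem_univ m⟩)]
      · simp [shearMatrix, hm, Ne.symm hm]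
      · intro k hk hkm
        have hk' : k ≠ i := Finset.ne_of_mem_erase hk
        simp [shearMatrix, hk', hkm]
  · rw [Finset.sum_eq_single_of_mem i (Finset.mem_univ i)]
    · simp [shearMatrix, hi, Matrix.one_apply]
    · intro k _ hk
      simp [shearMatrix, hi, Ne.symm hk]

/-- The shear matrix `B_(𝔡)^{[ℓ]}`, whose inverse is `B_(𝔡)^{[-ℓ]}`. -/
def matB {d : ℕ} (𝔡 : Fin d) (ℓ : {i : Fin d // i ≠ 𝔡} → ℤ) : GL (Fin d) ℝ where
  val := shearMatrix 𝔡 ℓ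
  inv := shearMatrix 𝔡 (-ℓ)
  val_inv := shearMatrix_mul_neg 𝔡 ℓ
  inv_val := by simpa using shearMatrix_mul_neg 𝔡 (-ℓ)

/-- The triples `(𝔡, j, ℓ)`: a direction `𝔡`, a scale `j ≥ 0` and a shear parameter `ℓ`, indexed
by the coordinates other than `𝔡`, with `|ℓ_i| ≤ 2^j` for all `i`. -/
abbrev ShearIndex (d : ℕ) : Type :=
  Σ 𝔡 : Fin d, Σ j : ℕ, ({i : Fin d // i ≠ 𝔡} → Finset.Icc (-2 ^ j : ℤ) (2 ^ j))

/-- The matrix `B_(𝔡)^{[ℓ]} A_(𝔡)^j`. -/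
def matBA {d : ℕ} (s : ShearIndex d) : GL (Fin d) ℝ :=
  matB s.1 (fun i => (s.2.2 i : ℤ)) * matA s.1 ^ s.2.1

/-- `|Q_j| = 2^{-(d+1)j}`, the volume of the cells `A^{-j} B^{-[ℓ]} ([0,1)^d + k)`. -/
def cellVol (d j : ℕ) : ℝ := (2 : ℝ) ^ (-(((d : ℝ) + 1) * j))

/-- The cone `|ξ_𝔡| ≥ 1/8`, `|ξ_i / ξ_𝔡| ≤ 1` for `i ≠ 𝔡`. -/
def cone {d : ℕ} (𝔡 : Fin d) : Set (E d) :=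
  {ξ | 1 / 8 ≤ |ξ 𝔡| ∧ ∀ i, i ≠ 𝔡 → |ξ i / ξ 𝔡| ≤ 1}

/-- The cube `[-1/8, 1/8]^d`. -/
def lowCube (d : ℕ) : Set (E d) := {ξ | ∀ i, |ξ i| ≤ 1 / 8}

/-- The row vector `ξ M`. -/
def rowMul {d : ℕ} (ξ : E d) (M : GL (Fin d) ℝ) : E d :=
  WithLp.toLp 2 (Matrix.vecMul ξ.ofLp (M : Matrix (Fin d) (Fin d) ℝ))

/-- The generators of the shearlet system on the cones: univariate windows `ψ̂₁`, `ψ̂₂`, the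
shearlet generators `ψ^(𝔡)`, one for every direction `𝔡`, and the low frequency function `Ψ`. -/
structure ShearletSystem (d : ℕ) where
  psi1Hat : ℝ → ℂ
  psi2Hat : ℝ → ℂ
  smooth1 : ContDiff ℝ (⊤ : ℕ∞) psi1Hat
  smooth2 : ContDiff ℝ (⊤ : ℕ∞) psi2Hat
  supp1 : tsupport psi1Hat ⊆ Set.Icc (-(1 / 2)) (-(1 / 16)) ∪ Set.Icc (1 / 16) (1 / 2)
  supp2 : tsupport psi2Hat ⊆ Set.Icc (-1) 1
  sum1 : ∀ ω : ℝ, 1 / 8 ≤ |ω| → HasSum (fun j : ℕ => ‖psi1Hat (ω / 2 ^ (2 * j))‖ ^ 2) 1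
  sum2 : ∀ ω : ℝ, |ω| ≤ 1 →
    ‖psi2Hat (ω - 1)‖ ^ 2 + ‖psi2Hat ω‖ ^ 2 + ‖psi2Hat (ω + 1)‖ ^ 2 = 1
  psi : Fin d → 𝓢(E d, ℂ)
  fourier_psi : ∀ (𝔡 : Fin d) (ξ : E d),
    𝓕 (psi 𝔡) ξ = psi1Hat (ξ 𝔡) * ∏ i ∈ Finset.univ.erase 𝔡, psi2Hat (ξ i / ξ 𝔡)
  Psi : 𝓢(E d, ℂ)
  supp_Psi : tsupport (𝓕 Psi : 𝓢(E d, ℂ)) ⊆ {ξ | ∀ i, |ξ i| ≤ 1 / 4}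
  Psi_eq_one : ∀ ξ ∈ lowCube d, ‖𝓕 Psi ξ‖ = 1
  /-- The Parseval frame condition; almost everywhere, because the cones and the cube overlap on
  their boundaries, which are null sets. -/
  parseval : ∀ᵐ ξ : E d, HasSum
    (fun s : ShearIndex d =>
      (cone s.1).indicator (fun ξ => ‖𝓕 (psi s.1) (rowMul ξ (matBA s)⁻¹)‖ ^ 2) ξ)
    (1 - (lowCube d).indicator (fun ξ => ‖𝓕 Psi ξ‖ ^ 2) ξ)

/-- The shearlet `ψ^(𝔡)_{j,ℓ,k}(x) = |det A_(𝔡)|^{j/2} ψ^(𝔡)(B_(𝔡)^{[ℓ]} A_(𝔡)^j x - k)`. -/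
def ShearletSystem.shearlet {d : ℕ} (S : ShearletSystem d) (s : ShearIndex d) (k : Fin d → ℤ) :
    𝓢(E d, ℂ) :=
  (((|(matA s.1 : Matrix (Fin d) (Fin d) ℝ).det| : ℝ) ^ ((s.2.1 : ℝ) / 2) : ℝ) : ℂ) •
    SchwartzMap.compCLMOfContinuousLinearEquiv ℂ (glEquiv (matBA s))
      (SchwartzMap.compSubConstCLM ℂ (WithLp.toLp 2 (fun i => (k i : ℝ))) (S.psi s.1))

/-- The index `(𝔡, j, 0)`. -/
def zeroShear {d : ℕ} (𝔡 : Fin d) (j : ℕ) : ShearIndex d :=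
  ⟨𝔡, j, fun _ => ⟨0, by simp⟩⟩

/-- The shear anisotropic quasi-norm of `F^{α,q}_p(AB)`:
`‖f ∗ Ψ‖_{L^p} + ‖(∑_{𝔡,j,ℓ} (|Q_j|^{-α} |f ∗ ψ̃^(𝔡)_{A^{-j} B^{-[ℓ]}}|)^q)^{1/q}‖_{L^p}`. -/
def ShearletSystem.normF {d : ℕ} (S : ShearletSystem d) (α p : ℝ) (q : ℝ≥0∞)
    (f : 𝓢'(E d, ℂ)) : ℝ≥0∞ :=
  lpNorm p (fun x => ‖conv f S.Psi x‖ₑ) +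
    lpNorm p (fun x => lq q (fun s : ShearIndex d =>
      ENNReal.ofReal (cellVol d s.2.1 ^ (-α)) *
        ‖conv f (dilate (matBA s)⁻¹ (tilde (S.psi s.1))) x‖ₑ))

end

end ShearTL

namespace ShearTL

/-! ### Mixed quasi-norms -/

/-! The test functions are multiples of `S.rescaled 𝔡 j`, that is `ψ(A^j x)`, divided by their own
shear quasi-norm. That quasi-norm is finite by Schwartz decay and frequency localisation
(`normF_rescaled_lt_top`), so only growth rates in `j` have to be compared.

In the shear scale the single block with index `(𝔡, j, 0)` suffices: its matrix is `A^j`, so a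
change of variables turns it into the fixed function `ψ * ψ̃`, which gives a lower bound of order
`2^{j((d+1)α₂ - (d+1)/p₂)}` (`exists_le_normF_rescaled`).

In the dyadic scale the frequency support lies in an annulus `|ξ| ~ 4^j`, so only a bounded number
of `ν` near `2j` contribute. Each block is dominated by a fixed decaying profile evaluated at `A^j
x`, whence an upper bound of order `2^{j(2α₁ - (d+1)/p₁)}` (`exists_normF_rescaled_le`).

The quotient is `O(2^{jb})`, and the hypothesis yields `b < 1 - d - 1/p₁ < 0`. -/

theorem lq_const_mul {ι : Type*} {q : ℝ≥0∞} (hq : 0 < q) (c : ℝ≥0∞)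
    (a : ι → ℝ≥0∞) : lq q (fun i => c * a i) = c * lq q a := by
  unfold lq
  split_ifs with h
  · rw [ENNReal.mul_iSup]
  · have hq' : 0 < q.toReal := ENNReal.toReal_pos hq.ne' h
    simp_rw [ENNReal.mul_rpow_of_nonneg _ _ hq'.le]
    rw [ENNReal.tsum_mul_left, ENNReal.mul_rpow_of_nonneg _ _ (by positivity),
      ← ENNReal.rpow_mul, mul_one_div_cancel hq'.ne', ENNReal.rpow_one]

theorem le_lq {ι : Type*} {q : ℝ≥0∞} (hq : 0 < q) (a : ι → ℝ≥0∞) (i : ι) : a i ≤ lq q a := by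
  unfold lq
  split_ifs with h
  · exact le_iSup a i
  · have hq' : 0 < q.toReal := ENNReal.toReal_pos hq.ne' h
    calc a i = (a i ^ q.toReal) ^ (1 / q.toReal) := by
          rw [← ENNReal.rpow_mul, mul_one_div_cancel hq'.ne', ENNReal.rpow_one]
      _ ≤ _ := ENNReal.rpow_le_rpow (ENNReal.le_tsum i) (by positivity)

/-- One formula serves every `q`: for `q = ∞` the conventions `∞.toReal = 0` and `1 / 0 = 0` turn
the cardinality factor into `1`. -/
theorem lq_le_of_finset {ι : Type*} {q : ℝ≥0∞} (hq : 0 < q) {a : ι → ℝ≥0∞} (T : Finset ι)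
    {B : ℝ≥0∞} (h0 : ∀ i ∉ T, a i = 0) (hB : ∀ i ∈ T, a i ≤ B) :
    lq q a ≤ (T.card : ℝ≥0∞) ^ (1 / q.toReal) * B := by
  unfold lq
  split_ifs with h
  · subst h
    simp only [ENNReal.toReal_top, div_zero, ENNReal.rpow_zero, one_mul]
    refine iSup_le fun i => ?_
    by_cases hi : i ∈ T
    · exact hB i hi
    · simp [h0 i hi]
  · have hq' : 0 < q.toReal := ENNReal.toReal_pos hq.ne' h
    rw [tsum_eq_sum (s := T) fun i hi => by rw [h0 i hi, ENNReal.zero_rpow_of_pos hq']]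
    calc (∑ i ∈ T, a i ^ q.toReal) ^ (1 / q.toReal)
        ≤ (∑ _i ∈ T, B ^ q.toReal) ^ (1 / q.toReal) := by
          refine ENNReal.rpow_le_rpow (Finset.sum_le_sum fun i hi => ?_) (by positivity)
          exact ENNReal.rpow_le_rpow (hB i hi) hq'.le
      _ = _ := by
          rw [Finset.sum_const, nsmul_eq_mul, ENNReal.mul_rpow_of_nonneg _ _ (by positivity),
            ← ENNReal.rpow_mul, mul_one_div_cancel hq'.ne', ENNReal.rpow_one]

section

variable {d : ℕ} {p : ℝ}

theorem lpNorm_const_mul (hp : 0 < p) {c : ℝ≥0∞} (hc : c ≠ ∞) (F : E d → ℝ≥0∞) :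
    lpNorm p (fun x => c * F x) = c * lpNorm p F := by
  unfold lpNorm
  simp_rw [ENNReal.mul_rpow_of_nonneg _ _ hp.le]
  rw [lintegral_const_mul' _ _ (ENNReal.rpow_ne_top_of_nonneg hp.le hc),
    ENNReal.mul_rpow_of_nonneg _ _ (by positivity), ← ENNReal.rpow_mul,
    mul_one_div_cancel hp.ne', ENNReal.rpow_one]

theorem lpNorm_mono (hp : 0 < p) {F G : E d → ℝ≥0∞} (h : ∀ x, F x ≤ G x) :
    lpNorm p F ≤ lpNorm p G :=
  ENNReal.rpow_le_rpow (lintegral_mono fun x => ENNReal.rpow_le_rpow (h x) hp.le) (by positivity)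

theorem lpNorm_zero (hp : 0 < p) : lpNorm p (fun _ : E d => 0) = 0 := by
  simp [lpNorm, ENNReal.zero_rpow_of_pos hp, hp]

theorem lpNorm_pos (hp : 0 < p) {f : E d → ℂ} (hf : Continuous f) {x : E d} (hx : f x ≠ 0) :
    0 < lpNorm p (fun x => ‖f x‖ₑ) := by
  unfold lpNorm
  refine pos_iff_ne_zero.2 fun h => ?_
  rw [ENNReal.rpow_eq_zero_iff_of_pos (by positivity), lintegral_eq_zero_iff
    ((hf.enorm.measurable).pow_const p)] at h
  have h' : (fun x => ‖f x‖) =ᵐ[volume] fun _ => 0 := by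
    filter_upwards [h] with y hy
    have hy' : ‖f y‖ₑ ^ p = 0 := hy
    rw [ENNReal.rpow_eq_zero_iff_of_pos hp] at hy'
    simpa using hy'
  have := congr_fun ((hf.norm.ae_eq_iff_eq volume continuous_const).1 h') x
  exact hx (norm_eq_zero.1 this)

/-! ### Linear changes of variables -/

theorem glEquiv_mul (M N : GL (Fin d) ℝ) (x : E d) :
    glEquiv (M * N) x = glEquiv M (glEquiv N x) := by
  simp [glEquiv_apply, Matrix.mulVec_mulVec]

theorem glEquiv_inv_apply (M : GL (Fin d) ℝ) (x : E d) : glEquiv M⁻¹ (glEquiv M x) = x := by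
  rw [← glEquiv_mul, inv_mul_cancel]
  simp [glEquiv_apply]

theorem map_glEquiv (M : GL (Fin d) ℝ) :
    Measure.map (glEquiv M) (volume : Measure (E d)) =
      ENNReal.ofReal |(M : Matrix (Fin d) (Fin d) ℝ).det|⁻¹ • volume := by
  have hdet : LinearMap.det (Matrix.toEuclideanLin (M : Matrix (Fin d) (Fin d) ℝ)) =
      (M : Matrix (Fin d) (Fin d) ℝ).det := by
    rw [Matrix.toEuclideanLin, Matrix.toLpLin_eq_toLin, LinearMap.det_toLin]
  have h0 : (M : Matrix (Fin d) (Fin d) ℝ).det ≠ 0 :=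
    ((Matrix.isUnit_iff_isUnit_det _).1 M.isUnit).ne_zero
  have h := Measure.map_linearMap_addHaar_eq_smul_addHaar (volume : Measure (E d))
    (f := Matrix.toEuclideanLin (M : Matrix (Fin d) (Fin d) ℝ)) (by rwa [hdet])
  rw [hdet, abs_inv] at h
  exact h

theorem integral_comp_glEquiv (M : GL (Fin d) ℝ) (F : E d → ℂ) :
    ∫ x, F (glEquiv M x) =
      ((|(M : Matrix (Fin d) (Fin d) ℝ).det|⁻¹ : ℝ) : ℂ) * ∫ x, F x := by
  have h := integral_map_equiv (μ := (volume : Measure (E d)))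
    (glEquiv M).toHomeomorph.toMeasurableEquiv F
  have e : ⇑(glEquiv M).toHomeomorph.toMeasurableEquiv = glEquiv M := rfl
  rw [e, map_glEquiv, integral_smul_measure, ENNReal.toReal_ofReal (by positivity)] at h
  rw [← h, Complex.real_smul]

theorem lpNorm_comp_glEquiv (hp : 0 < p) (M : GL (Fin d) ℝ) (F : E d → ℝ≥0∞) :
    lpNorm p (fun x => F (glEquiv M x)) =
      ENNReal.ofReal (|(M : Matrix (Fin d) (Fin d) ℝ).det| ^ (-1 / p)) * lpNorm p F := by
  have h := lintegral_map_equiv (μ := (volume : Measure (E d))) (fun x => F x ^ p)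
    (glEquiv M).toHomeomorph.toMeasurableEquiv
  have e : ⇑(glEquiv M).toHomeomorph.toMeasurableEquiv = glEquiv M := rfl
  rw [e, map_glEquiv, lintegral_smul_measure] at h
  have h0 : 0 < |(M : Matrix (Fin d) (Fin d) ℝ).det| :=
    abs_pos.2 ((Matrix.isUnit_iff_isUnit_det _).1 M.isUnit).ne_zero
  unfold lpNorm
  rw [← h, smul_eq_mul, ENNReal.mul_rpow_of_nonneg _ _ (by positivity),
    ENNReal.ofReal_rpow_of_pos (by positivity), Real.inv_rpow h0.le, ← Real.rpow_neg h0.le]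
  congr 4
  ring

/-! ### Convolutions of Schwartz functions -/

theorem conv_eq_convolution (f g : 𝓢(E d, ℂ)) (x : E d) :
    conv (f : 𝓢'(E d, ℂ)) g x =
      SchwartzMap.convolution (ContinuousLinearMap.mul ℂ ℂ) f g x := by
  rw [conv_coe, SchwartzMap.convolution_apply, convolution_def]
  rfl

theorem conv_smul_left (c : ℂ) (f g : 𝓢(E d, ℂ)) (x : E d) :
    conv ((c • f : 𝓢(E d, ℂ)) : 𝓢'(E d, ℂ)) g x = c * conv (f : 𝓢'(E d, ℂ)) g x := by
  rw [conv_coe, conv_coe, ← integral_const_mul]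
  simp [mul_assoc]

/-- The Fourier transform of a convolution is the product, which vanishes identically here;
injectivity of the transform does the rest. Every frequency-support argument below passes through
this. -/
theorem conv_eq_zero {f g : 𝓢(E d, ℂ)} (h : ∀ ξ, 𝓕 f ξ = 0 ∨ 𝓕 g ξ = 0) (x : E d) :
    conv (f : 𝓢'(E d, ℂ)) g x = 0 := by
  have h0 : 𝓕 (SchwartzMap.convolution (ContinuousLinearMap.mul ℂ ℂ) f g) = 0 := by
    ext ξ
    have e := SchwartzMap.fourier_convolution (ContinuousLinearMap.mul ℂ ℂ) f g
    rw [e]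
    rcases h ξ with h | h <;> simp [SchwartzMap.pairing, h]
  have h1 : SchwartzMap.convolution (ContinuousLinearMap.mul ℂ ℂ) f g = 0 := by
    refine (FourierTransform.fourierCLE ℂ 𝓢(E d, ℂ)).injective ?_
    rw [map_zero]
    exact h0
  rw [conv_eq_convolution, h1]
  rfl

theorem exists_decay (f : 𝓢(E d, ℂ)) (N : ℕ) :
    ∃ C, 0 < C ∧ ∀ x, ‖f x‖ ≤ C * ((1 + ‖x‖) ^ N)⁻¹ := by
  have h := SchwartzMap.one_add_le_sup_seminorm_apply (𝕜 := ℂ) (m := (N, 0)) (k := N) (n := 0)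
    le_rfl le_rfl f
  set C := 2 ^ N * ((Finset.Iic (N, 0)).sup fun m => SchwartzMap.seminorm ℂ m.1 m.2) f
  refine ⟨|C| + 1, by positivity, fun x => ?_⟩
  have hx := h x
  rw [norm_iteratedFDeriv_zero] at hx
  rw [← div_eq_mul_inv, le_div_iff₀ (by positivity), mul_comm]
  linarith [le_abs_self C]

theorem lpNorm_decay_lt_top (hp : 0 < p) {N : ℕ} (hN : (d : ℝ) < N * p) :
    lpNorm p (fun x : E d => ENNReal.ofReal (((1 + ‖x‖) ^ N)⁻¹)) < ∞ := by
  unfold lpNorm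
  refine ENNReal.rpow_lt_top_of_nonneg (by positivity) (ne_of_lt ?_)
  have h := finite_integral_one_add_norm (E := E d) (μ := volume) (r := N * p) (by simpa using hN)
  refine lt_of_eq_of_lt (lintegral_congr fun x => ?_) h
  have hx : 0 < 1 + ‖x‖ := by positivity
  rw [ENNReal.ofReal_rpow_of_pos (by positivity), ← Real.rpow_natCast, ← Real.rpow_neg hx.le,
    ← Real.rpow_mul hx.le, neg_mul]

theorem lpNorm_lt_top_of_decay (hp : 0 < p) {N : ℕ} (hN : (d : ℝ) < N * p) {F : E d → ℝ≥0∞}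
    {C : ℝ≥0∞} (hC : C ≠ ∞) (hF : ∀ x, F x ≤ C * ENNReal.ofReal (((1 + ‖x‖) ^ N)⁻¹)) :
    lpNorm p F < ∞ := by
  refine (lpNorm_mono hp hF).trans_lt ?_
  rw [lpNorm_const_mul hp hC]
  exact ENNReal.mul_lt_top hC.lt_top (lpNorm_decay_lt_top hp hN)

/-- A Schwartz function integrated against another one composed with `u ↦ z - T u` decays in `z`,
uniformly over the linear maps `T` of norm at most `R`. -/
theorem exists_integral_decay (φ ψ : 𝓢(E d, ℂ)) (N : ℕ) {R : ℝ} (hR : 1 ≤ R) :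
    ∃ K, 0 < K ∧ ∀ T : E d → E d, (∀ u, ‖T u‖ ≤ R * ‖u‖) → ∀ z,
      ‖∫ u, φ u * ψ (z - T u)‖ ≤ K * ((1 + ‖z‖) ^ N)⁻¹ := by
  obtain ⟨C, hC, hψ⟩ := exists_decay ψ N
  -- `N` powers of decay absorb the growth coming from moving the weight from `z - T u` to `z`; the
  -- other `d + 1` make the integral in `u` converge.
  obtain ⟨C', hC', hφ⟩ := exists_decay φ (N + (d + 1))
  have hint : Integrable (fun u : E d => ((1 + ‖u‖) ^ (d + 1))⁻¹) := by
    have := integrable_one_add_norm (E := E d) (μ := volume) (r := ((d + 1 : ℕ) : ℝ)) (by simp)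
    refine this.congr (Eventually.of_forall fun u => ?_)
    have hu : 0 < 1 + ‖u‖ := by positivity
    simp only
    rw [Real.rpow_neg hu.le, Real.rpow_natCast]
  set I := ∫ u : E d, ((1 + ‖u‖) ^ (d + 1))⁻¹
  have hI : 0 ≤ I := integral_nonneg fun u => by positivity
  refine ⟨C * C' * R ^ N * (I + 1), by positivity, fun T hT z => ?_⟩
  have hpt : ∀ u, ‖φ u * ψ (z - T u)‖ ≤
      (C * C' * R ^ N * ((1 + ‖z‖) ^ N)⁻¹) * ((1 + ‖u‖) ^ (d + 1))⁻¹ := by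
    intro u
    -- Peetre's inequality, uniform in `T`; this is where `1 ≤ R` enters.
    have h1 : 1 + ‖z‖ ≤ (1 + ‖z - T u‖) * (R * (1 + ‖u‖)) := by
      have h2 : ‖z‖ ≤ ‖z - T u‖ + ‖T u‖ := by simpa using norm_add_le (z - T u) (T u)
      have h3 := hT u
      have h4 : 0 ≤ ‖z - T u‖ * (R * (1 + ‖u‖) - 1) := by
        refine mul_nonneg (norm_nonneg _) ?_
        nlinarith [norm_nonneg u]
      nlinarith
    have h5 : ((1 + ‖z - T u‖) ^ N)⁻¹ ≤ R ^ N * (1 + ‖u‖) ^ N * ((1 + ‖z‖) ^ N)⁻¹ := by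
      rw [← div_eq_mul_inv, le_div_iff₀ (by positivity), ← div_eq_inv_mul,
        div_le_iff₀ (by positivity), ← mul_pow, ← mul_pow]
      refine pow_le_pow_left₀ (by positivity) ?_ N
      linarith
    rw [norm_mul]
    calc ‖φ u‖ * ‖ψ (z - T u)‖
        ≤ (C' * ((1 + ‖u‖) ^ (N + (d + 1)))⁻¹) *
            (C * (R ^ N * (1 + ‖u‖) ^ N * ((1 + ‖z‖) ^ N)⁻¹)) :=
          mul_le_mul (hφ u) ((hψ _).trans (by gcongr)) (norm_nonneg _) (by positivity)
      _ = _ := by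
          rw [pow_add]
          field_simp
  calc ‖∫ u, φ u * ψ (z - T u)‖
      ≤ ∫ u, (C * C' * R ^ N * ((1 + ‖z‖) ^ N)⁻¹) * ((1 + ‖u‖) ^ (d + 1))⁻¹ :=
        norm_integral_le_of_norm_le (hint.const_mul _) (Eventually.of_forall hpt)
    _ = C * C' * R ^ N * I * ((1 + ‖z‖) ^ N)⁻¹ := by
        rw [integral_const_mul]; ring
    _ ≤ _ := by gcongr; linarith

/-! ### Dilations and the Fourier transform -/

theorem inner_glEquiv (M : GL (Fin d) ℝ) (x ξ : E d) :
    inner ℝ (glEquiv M x) ξ = inner ℝ x (rowMul ξ M) := by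
  simp only [glEquiv_apply, rowMul, EuclideanSpace.inner_eq_star_dotProduct, star_trivial]
  rw [Matrix.dotProduct_mulVec]

theorem fourier_comp_glEquiv (M : GL (Fin d) ℝ) (ψ : 𝓢(E d, ℂ)) (ξ : E d) :
    𝓕 (SchwartzMap.compCLMOfContinuousLinearEquiv ℂ (glEquiv M) ψ) ξ =
      ((|(M : Matrix (Fin d) (Fin d) ℝ).det|⁻¹ : ℝ) : ℂ) * 𝓕 ψ (rowMul ξ M⁻¹) := by
  rw [SchwartzMap.fourier_coe, SchwartzMap.fourier_coe, Real.fourier_eq, Real.fourier_eq,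
    ← integral_comp_glEquiv]
  refine integral_congr_ae (Eventually.of_forall fun x => ?_)
  simp only [SchwartzMap.compCLMOfContinuousLinearEquiv_apply, Function.comp_apply]
  rw [← inner_glEquiv, glEquiv_inv_apply]

theorem fourier_dilate_eq_zero (M : GL (Fin d) ℝ) {ψ : 𝓢(E d, ℂ)} {ξ : E d}
    (h : 𝓕 ψ (rowMul ξ M) = 0) : 𝓕 (dilate M ψ) ξ = 0 := by
  have e : 𝓕 (dilate M ψ) =
      ((|(M : Matrix (Fin d) (Fin d) ℝ).det|⁻¹ : ℝ) : ℂ) •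
        𝓕 (SchwartzMap.compCLMOfContinuousLinearEquiv ℂ (glEquiv M⁻¹) ψ) :=
    map_smul (FourierTransform.fourierCLM ℂ 𝓢(E d, ℂ)) _ _
  rw [e, smul_apply, fourier_comp_glEquiv, inv_inv, h]
  simp

theorem fourier_tilde (ψ : 𝓢(E d, ℂ)) (ξ : E d) :
    𝓕 (tilde ψ) ξ = (starRingEnd ℂ) (𝓕 ψ ξ) := by
  rw [SchwartzMap.fourier_coe, SchwartzMap.fourier_coe, Real.fourier_eq', Real.fourier_eq',
    ← integral_conj, ← integral_neg_eq_self]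
  refine integral_congr_ae (Eventually.of_forall fun x => ?_)
  simp only [tilde_apply, smul_eq_mul, map_mul, neg_neg, ← Complex.exp_conj, inner_neg_left]
  simp [Complex.conj_ofNat]

theorem fourier_dyadicDilate_eq_zero (ν : ℕ) {φ : 𝓢(E d, ℂ)} {ξ : E d}
    (h : 𝓕 φ (((2 : ℝ) ^ ν)⁻¹ • ξ) = 0) : 𝓕 (dyadicDilate ν φ) ξ = 0 := by
  rw [SchwartzMap.fourier_coe, Real.fourier_eq] at h ⊢
  have h2 : ((2 : ℝ) ^ ν) ≠ 0 := by positivity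
  have := Measure.integral_comp_smul (volume : Measure (E d))
    (fun v => Real.fourierChar (-inner ℝ v (((2 : ℝ) ^ ν)⁻¹ • ξ)) • φ v) ((2 : ℝ) ^ ν)
  rw [h, smul_zero] at this
  simp only [inner_smul_left, inner_smul_right, starRingEnd_apply, star_trivial,
    inv_mul_cancel_left₀ h2] at this
  simp only [dyadicDilate_apply, Circle.smul_def, smul_eq_mul, mul_left_comm _ ((2 : ℂ) ^ (d * ν))]
    at this ⊢
  rw [integral_const_mul, this, mul_zero]

/-- The normalisation of `dilate` cancels the Jacobian exactly, so a block at the same scale as the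
function is the unscaled block composed with `M`. -/
theorem conv_comp_dilate (M : GL (Fin d) ℝ) (f g : 𝓢(E d, ℂ)) (x : E d) :
    conv ((SchwartzMap.compCLMOfContinuousLinearEquiv ℂ (glEquiv M) f : 𝓢(E d, ℂ)) :
      𝓢'(E d, ℂ)) (dilate M⁻¹ g) x = conv (f : 𝓢'(E d, ℂ)) g (glEquiv M x) := by
  rw [conv_coe, conv_coe]
  have h0 : 0 < |(M : Matrix (Fin d) (Fin d) ℝ).det| :=
    abs_pos.2 ((Matrix.isUnit_iff_isUnit_det _).1 M.isUnit).ne_zero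
  have h1 : |((M⁻¹ : GL (Fin d) ℝ) : Matrix (Fin d) (Fin d) ℝ).det|⁻¹ =
      |(M : Matrix (Fin d) (Fin d) ℝ).det| := by
    rw [Matrix.coe_units_inv, Matrix.det_nonsing_inv, Ring.inverse_eq_inv', abs_inv, inv_inv]
  have := integral_comp_glEquiv M (fun y => f y * g (glEquiv M x - y))
  rw [← mul_right_inj' (a := ((|(M : Matrix (Fin d) (Fin d) ℝ).det|⁻¹ : ℝ) : ℂ))
    (by exact_mod_cast (inv_pos.2 h0).ne'), ← this, ← integral_const_mul]
  refine integral_congr_ae (Eventually.of_forall fun y => ?_)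
  simp only [SchwartzMap.compCLMOfContinuousLinearEquiv_apply, Function.comp_apply, dilate_apply,
    h1, inv_inv, map_sub]
  have h2 : ((|(M : Matrix (Fin d) (Fin d) ℝ).det| : ℝ) : ℂ) ≠ 0 := by exact_mod_cast h0.ne'
  push_cast
  field_simp

/-- Substituting `u = 2^ν (x - y)` moves both scales into the linear map `2^{-ν} M`, the form
required by `exists_integral_decay`. -/
theorem conv_comp_dyadicDilate (M : GL (Fin d) ℝ) (f φ : 𝓢(E d, ℂ)) (ν : ℕ) (x : E d) :
    conv ((SchwartzMap.compCLMOfContinuousLinearEquiv ℂ (glEquiv M) f : 𝓢(E d, ℂ)) :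
      𝓢'(E d, ℂ)) (dyadicDilate ν φ) x =
        ∫ u, φ u * f (glEquiv M x - ((2 : ℝ) ^ ν)⁻¹ • glEquiv M u) := by
  rw [conv_coe]
  have h2 : ((2 : ℝ) ^ ν) ≠ 0 := by positivity
  have h3 : (2 : ℂ) ^ (d * ν) ≠ 0 := pow_ne_zero _ two_ne_zero
  have := Measure.integral_comp_smul (volume : Measure (E d))
    (fun u => φ u * f (glEquiv M x - ((2 : ℝ) ^ ν)⁻¹ • glEquiv M u)) ((2 : ℝ) ^ ν)
  simp only [map_smul, smul_smul, inv_mul_cancel₀ h2, one_smul] at this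
  rw [← integral_sub_left_eq_self _ _ x]
  simp only [SchwartzMap.compCLMOfContinuousLinearEquiv_apply, Function.comp_apply,
    dyadicDilate_apply, sub_sub_cancel, map_sub]
  rw [show (fun y : E d => f (glEquiv M x - glEquiv M y) *
      ((2 : ℂ) ^ (d * ν) * φ ((2 : ℝ) ^ ν • y))) = fun y => (2 : ℂ) ^ (d * ν) *
      (φ ((2 : ℝ) ^ ν • y) * f (glEquiv M x - glEquiv M y)) by ext; ring,
    integral_const_mul, this, abs_of_pos (by positivity), finrank_euclideanSpace_fin,
    Complex.real_smul, ← mul_assoc]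
  push_cast
  rw [← pow_mul, mul_comm ν d, mul_inv_cancel₀ h3, one_mul]

end

end ShearTL
namespace ShearTL

section

variable {d : ℕ}

/-! ### Homogeneity of the two quasi-norms -/

theorem DyadicSystem.normF_smul (D : DyadicSystem d) (α : ℝ) {p : ℝ} {q : ℝ≥0∞} (hp : 0 < p)
    (hq : 0 < q) (c : ℂ) (f : 𝓢(E d, ℂ)) :
    D.normF α p q ((c • f : 𝓢(E d, ℂ)) : 𝓢'(E d, ℂ)) =
      ‖c‖ₑ * D.normF α p q (f : 𝓢'(E d, ℂ)) := by
  simp only [DyadicSystem.normF, conv_smul_left, enorm_mul, mul_left_comm _ ‖c‖ₑ,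
    lq_const_mul hq, lpNorm_const_mul hp enorm_ne_top, mul_add]

theorem ShearletSystem.normF_smul (S : ShearletSystem d) (α : ℝ) {p : ℝ} {q : ℝ≥0∞} (hp : 0 < p)
    (hq : 0 < q) (c : ℂ) (f : 𝓢(E d, ℂ)) :
    S.normF α p q ((c • f : 𝓢(E d, ℂ)) : 𝓢'(E d, ℂ)) =
      ‖c‖ₑ * S.normF α p q (f : 𝓢'(E d, ℂ)) := by
  simp only [ShearletSystem.normF, conv_smul_left, enorm_mul, mul_left_comm _ ‖c‖ₑ,
    lq_const_mul hq, lpNorm_const_mul hp enorm_ne_top, mul_add]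

/-! ### The matrices of the shearlet system -/

theorem coe_matA_pow (𝔡 : Fin d) (j : ℕ) :
    ((matA 𝔡 ^ j : GL (Fin d) ℝ) : Matrix (Fin d) (Fin d) ℝ) =
      Matrix.diagonal fun i => (if i = 𝔡 then (4 : ℝ) else 2) ^ j := by
  have h : ((matA 𝔡 : GL (Fin d) ℝ) : Matrix (Fin d) (Fin d) ℝ) =
      Matrix.diagonal fun i => if i = 𝔡 then (4 : ℝ) else 2 := rfl
  rw [Units.val_pow_eq_pow_val, h, Matrix.diagonal_pow]
  rfl

theorem det_matA_pow (𝔡 : Fin d) (j : ℕ) :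
    ((matA 𝔡 ^ j : GL (Fin d) ℝ) : Matrix (Fin d) (Fin d) ℝ).det = 2 ^ ((d + 1) * j) := by
  have h : ∀ i : Fin d, (if i = 𝔡 then (4 : ℝ) else 2) = 2 * if i = 𝔡 then 2 else 1 := by
    intro i
    split_ifs <;> norm_num
  rw [coe_matA_pow, Matrix.det_diagonal, Finset.prod_pow]
  simp only [h]
  rw [Finset.prod_mul_distrib, Finset.prod_ite_eq' Finset.univ 𝔡]
  simp [pow_mul, pow_succ]

theorem abs_det_matA_pow_rpow (𝔡 : Fin d) (j : ℕ) (p : ℝ) :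
    |((matA 𝔡 ^ j : GL (Fin d) ℝ) : Matrix (Fin d) (Fin d) ℝ).det| ^ (-1 / p) =
      (2 : ℝ) ^ (j * -((d + 1) / p)) := by
  rw [det_matA_pow, abs_of_pos (by positivity), ← Real.rpow_natCast,
    ← Real.rpow_mul (by norm_num)]
  push_cast
  ring_nf

theorem matBA_zeroShear (𝔡 : Fin d) (j : ℕ) : matBA (zeroShear 𝔡 j) = matA 𝔡 ^ j := by
  have h : matB 𝔡 (0 : {i : Fin d // i ≠ 𝔡} → ℤ) = 1 := by
    ext i k
    simp only [matB, shearMatrix, Units.val_one, Matrix.of_apply, Matrix.one_apply]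
    by_cases hi : i = 𝔡
    · by_cases hk : k = 𝔡
      · simp [hi, hk]
      · simp [hi, hk, Ne.symm hk]
    · simp [hi]
  change matB 𝔡 0 * matA 𝔡 ^ j = _
  rw [h, one_mul]

theorem norm_glEquiv_matA_pow_le (𝔡 : Fin d) (j : ℕ) (u : E d) :
    ‖glEquiv (matA 𝔡 ^ j) u‖ ≤ 4 ^ j * ‖u‖ := by
  have h : (4 : ℝ) ^ j * ‖u‖ = ‖(4 : ℝ) ^ j • u‖ := by
    rw [norm_smul, norm_pow, Real.norm_ofNat]
  rw [h, EuclideanSpace.norm_eq, EuclideanSpace.norm_eq]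
  refine Real.sqrt_le_sqrt (Finset.sum_le_sum fun i _ => ?_)
  rw [glEquiv_apply, coe_matA_pow]
  simp only [Matrix.mulVec_diagonal, PiLp.smul_apply, smul_eq_mul, norm_mul, norm_pow]
  gcongr
  split_ifs <;> norm_num

theorem rowMul_inv_rowMul (ξ : E d) (M : GL (Fin d) ℝ) : rowMul (rowMul ξ M⁻¹) M = ξ := by
  unfold rowMul
  simp only [Matrix.vecMul_vecMul]
  rw [← Units.val_mul, inv_mul_cancel]
  simp

theorem rowMul_matA_pow_apply (ξ : E d) (𝔡 : Fin d) (j : ℕ) (i : Fin d) :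
    rowMul ξ (matA 𝔡 ^ j) i = ξ i * (if i = 𝔡 then (4 : ℝ) else 2) ^ j := by
  simp only [rowMul]
  rw [coe_matA_pow, Matrix.vecMul_diagonal]

/-- Column `𝔡` of the shear matrix is the unit vector `e_𝔡`, so shearing leaves this coordinate of
the row vector alone. Frequency lower bounds are therefore uniform in `ℓ`. -/
theorem rowMul_matBA_apply (ξ : E d) (s : ShearIndex d) :
    rowMul ξ (matBA s) s.1 = ξ s.1 * 4 ^ s.2.1 := by
  have h : rowMul ξ (matBA s) =
      rowMul (rowMul ξ (matB s.1 fun i => (s.2.2 i : ℤ))) (matA s.1 ^ s.2.1) := by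
    simp [rowMul, matBA]
  rw [h, rowMul_matA_pow_apply, if_pos rfl]
  congr 1
  simp only [rowMul, matB, Matrix.vecMul, dotProduct]
  rw [Finset.sum_eq_single s.1]
  · simp [shearMatrix]
  · intro i _ hi
    simp [shearMatrix, hi]
  · simp

/-! ### Frequency supports -/

theorem ShearletSystem.of_psi1Hat_ne_zero (S : ShearletSystem d) {t : ℝ} (ht : S.psi1Hat t ≠ 0) :
    1 / 16 ≤ |t| ∧ |t| ≤ 1 / 2 := by
  rcases S.supp1 (subset_tsupport _ ht) with h | h
  · rw [abs_of_neg (by linarith [h.2])]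
    exact ⟨by linarith [h.2], by linarith [h.1]⟩
  · rw [abs_of_pos (by linarith [h.1])]
    exact h

theorem ShearletSystem.of_fourier_psi_ne_zero (S : ShearletSystem d) {𝔡 : Fin d} {ξ : E d}
    (h : 𝓕 (S.psi 𝔡) ξ ≠ 0) : 1 / 16 ≤ |ξ 𝔡| ∧ ∀ i, |ξ i| ≤ 1 := by
  rw [S.fourier_psi, mul_ne_zero_iff, Finset.prod_ne_zero_iff] at h
  have h1 := S.of_psi1Hat_ne_zero h.1
  refine ⟨h1.1, fun i => ?_⟩
  by_cases hi : i = 𝔡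
  · subst hi
    linarith
  · have h2 := abs_le.2 (S.supp2 (subset_tsupport _ (h.2 i (by simp [hi]))))
    have h0 : 0 < |ξ 𝔡| := by linarith
    rw [abs_div, div_le_one h0] at h2
    linarith

theorem ShearletSystem.psi_ne_zero (S : ShearletSystem d) (𝔡 : Fin d) : S.psi 𝔡 ≠ 0 := by
  intro h
  obtain ⟨t, ht⟩ : ∃ t, S.psi1Hat t ≠ 0 := by
    by_contra! hc
    have := S.sum1 1 (by norm_num)
    simp only [hc, norm_zero, ne_eq, OfNat.ofNat_ne_zero, not_false_eq_true, zero_pow] at this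
    exact zero_ne_one (hasSum_zero.unique this)
  obtain ⟨w, hw⟩ : ∃ w, S.psi2Hat w ≠ 0 := by
    by_contra! hc
    simpa [hc] using S.sum2 0 (by norm_num)
  have ht0 : t ≠ 0 := by
    rintro rfl
    have := (S.of_psi1Hat_ne_zero ht).1
    norm_num at this
  -- At this point `ξ_𝔡 = t` and every slope `ξ_i / ξ_𝔡` equals `w`, so no window factor vanishes.
  have h0 := S.fourier_psi 𝔡 (WithLp.toLp 2 fun i => if i = 𝔡 then t else w * t)
  have hz : 𝓕 (S.psi 𝔡) = 0 := by
    rw [h]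
    exact map_zero (FourierTransform.fourierCLM ℂ 𝓢(E d, ℂ))
  rw [hz, zero_apply, eq_comm, mul_eq_zero, Finset.prod_eq_zero_iff] at h0
  rcases h0 with h0 | ⟨i, hi, h0⟩
  · simp [ht] at h0
  · have hi' : i ≠ 𝔡 := Finset.ne_of_mem_erase hi
    simp [hi', ht0, hw] at h0

/-- The anisotropically rescaled generator `x ↦ ψ^(𝔡)(A_(𝔡)^j x)`. -/
noncomputable def ShearletSystem.rescaled (S : ShearletSystem d) (𝔡 : Fin d) (j : ℕ) :
    𝓢(E d, ℂ) :=
  SchwartzMap.compCLMOfContinuousLinearEquiv ℂ (glEquiv (matA 𝔡 ^ j)) (S.psi 𝔡)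

theorem ShearletSystem.shearlet_zeroShear (S : ShearletSystem d) (𝔡 : Fin d) (j : ℕ) :
    ∃ c : ℂ, c ≠ 0 ∧ S.shearlet (zeroShear 𝔡 j) 0 = c • S.rescaled 𝔡 j := by
  have hdet : 0 < |(matA 𝔡 : Matrix (Fin d) (Fin d) ℝ).det| :=
    abs_pos.2 ((Matrix.isUnit_iff_isUnit_det _).1 (matA 𝔡).isUnit).ne_zero
  refine ⟨_, Complex.ofReal_ne_zero.2 (Real.rpow_pos_of_pos hdet ((j : ℝ) / 2)).ne', ?_⟩
  unfold ShearletSystem.shearlet ShearletSystem.rescaled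
  rw [matBA_zeroShear]
  congr 1
  ext x
  simp only [SchwartzMap.compCLMOfContinuousLinearEquiv_apply, Function.comp_apply]
  change S.psi 𝔡 (glEquiv (matA 𝔡 ^ j) x -
    WithLp.toLp 2 (fun i => (((0 : Fin d → ℤ) i : ℤ) : ℝ))) = _
  congr 1
  ext i
  simp

theorem ShearletSystem.of_fourier_rescaled_ne_zero (S : ShearletSystem d) {𝔡 : Fin d} {j : ℕ}
    {ξ : E d} (h : 𝓕 (S.rescaled 𝔡 j) ξ ≠ 0) : 4 ^ j / 16 ≤ ‖ξ‖ ∧ ‖ξ‖ ≤ d * 4 ^ j := by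
  rw [ShearletSystem.rescaled, fourier_comp_glEquiv] at h
  obtain ⟨h1, h2⟩ := S.of_fourier_psi_ne_zero (right_ne_zero_of_mul h)
  set η := rowMul ξ (matA 𝔡 ^ j)⁻¹ with hη
  have hξ : ∀ i, ξ i = η i * (if i = 𝔡 then (4 : ℝ) else 2) ^ j := by
    intro i
    rw [← rowMul_matA_pow_apply, hη, rowMul_inv_rowMul]
  have h4 : (0 : ℝ) < 4 ^ j := by positivity
  constructor
  · refine le_trans ?_ (PiLp.norm_apply_le ξ 𝔡)
    rw [hξ, if_pos rfl, norm_mul, norm_pow, Real.norm_ofNat, Real.norm_eq_abs]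
    nlinarith
  · rw [EuclideanSpace.norm_eq, Real.sqrt_le_iff]
    refine ⟨by positivity, ?_⟩
    have h5 : ∀ i, ‖ξ i‖ ^ 2 ≤ (4 ^ j) ^ 2 := by
      intro i
      rw [hξ, norm_mul, norm_pow, Real.norm_eq_abs]
      refine pow_le_pow_left₀ (by positivity) ?_ 2
      calc |η i| * ‖if i = 𝔡 then (4 : ℝ) else 2‖ ^ j ≤ 1 * 4 ^ j := by
            gcongr
            · exact h2 i
            · split_ifs <;> norm_num
        _ = 4 ^ j := one_mul _
    have hd : (1 : ℝ) ≤ d := by exact_mod_cast (Fin.pos 𝔡)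
    calc ∑ i, ‖ξ i‖ ^ 2 ≤ ∑ _i : Fin d, ((4 : ℝ) ^ j) ^ 2 := Finset.sum_le_sum fun i _ => h5 i
      _ = d * (4 ^ j) ^ 2 := by simp
      _ ≤ (d * 4 ^ j) ^ 2 := by
        rw [mul_pow]
        gcongr
        nlinarith

/-- No upper bound is needed: the lower one already separates all fine scales from a function with
bounded frequency support. -/
theorem ShearletSystem.of_fourier_dilate_tilde_ne_zero (S : ShearletSystem d) {s : ShearIndex d}
    {ξ : E d} (h : 𝓕 (dilate (matBA s)⁻¹ (tilde (S.psi s.1))) ξ ≠ 0) :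
    4 ^ s.2.1 / 16 ≤ ‖ξ‖ := by
  have h' : 𝓕 (S.psi s.1) (rowMul ξ (matBA s)⁻¹) ≠ 0 := by
    contrapose! h
    refine fourier_dilate_eq_zero _ ?_
    rw [fourier_tilde, h, map_zero]
  have h1 := (S.of_fourier_psi_ne_zero h').1
  refine le_trans ?_ (PiLp.norm_apply_le ξ s.1)
  rw [← rowMul_inv_rowMul ξ (matBA s), rowMul_matBA_apply, norm_mul, norm_pow, Real.norm_ofNat,
    Real.norm_eq_abs]
  have h4 : (0 : ℝ) < 4 ^ s.2.1 := by positivity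
  nlinarith

theorem DyadicSystem.of_fourier_dyadicDilate_ne_zero (D : DyadicSystem d) {ν : ℕ} {ξ : E d}
    (h : 𝓕 (dyadicDilate ν D.phi) ξ ≠ 0) : 2 ^ ν / 2 ≤ ‖ξ‖ ∧ ‖ξ‖ ≤ 2 * 2 ^ ν := by
  have h' : 𝓕 D.phi (((2 : ℝ) ^ ν)⁻¹ • ξ) ≠ 0 := by
    contrapose! h
    exact fourier_dyadicDilate_eq_zero _ h
  obtain ⟨h1, h2⟩ := D.supp_phi (subset_tsupport _ h')
  rw [norm_smul, norm_inv, norm_pow, Real.norm_ofNat, ← div_eq_inv_mul] at h1 h2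
  have h3 : (0 : ℝ) < 2 ^ ν := by positivity
  rw [le_div_iff₀ h3] at h1
  rw [div_le_iff₀ h3] at h2
  exact ⟨by linarith, h2⟩

/-! ### The quasi-norms of the rescaled generators -/

/-- The value at the origin is `‖ψ‖²` in `L²`. -/
theorem conv_tilde_self_ne_zero {ψ : 𝓢(E d, ℂ)} (h : ψ ≠ 0) :
    conv (ψ : 𝓢'(E d, ℂ)) (tilde ψ) 0 ≠ 0 := by
  intro h0
  rw [conv_coe] at h0
  have h1 : ∀ y, ψ y * tilde ψ (0 - y) = ((‖ψ y‖ ^ 2 : ℝ) : ℂ) := by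
    intro y
    rw [tilde_apply, zero_sub, neg_neg, Complex.mul_conj, Complex.normSq_eq_norm_sq]
  simp only [h1] at h0
  rw [integral_complex_ofReal, Complex.ofReal_eq_zero] at h0
  have hint : Integrable (fun y => ‖ψ y‖ ^ 2) := by
    have := (ψ.memLp 2 volume).integrable_norm_pow (by norm_num)
    simpa using this
  have hc : Continuous fun y => ‖ψ y‖ ^ 2 := (ψ.continuous.norm.pow 2)
  rw [integral_eq_zero_iff_of_nonneg (fun y => by positivity) hint] at h0
  have h2 := (hc.ae_eq_iff_eq volume continuous_const).1 h0
  refine h (DFunLike.ext _ _ fun y => ?_)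
  have h3 : ‖ψ y‖ ^ 2 = 0 := congr_fun h2 y
  exact norm_eq_zero.1 ((pow_eq_zero_iff two_ne_zero).1 h3)

/-- Only finitely many shear indices meet the frequency support, and each block is Schwartz. The
bound may depend on `j`, since finiteness is all that the normalisation uses. -/
theorem ShearletSystem.normF_rescaled_lt_top (S : ShearletSystem d) (𝔡 : Fin d) (j : ℕ) (α : ℝ)
    {p : ℝ} {q : ℝ≥0∞} (hp : 0 < p) (hq : 0 < q) :
    S.normF α p q (S.rescaled 𝔡 j : 𝓢'(E d, ℂ)) < ∞ := by
  obtain ⟨N, hN⟩ := exists_nat_gt ((d : ℝ) / p)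
  rw [div_lt_iff₀ hp] at hN
  have hdec : ∀ g : 𝓢(E d, ℂ), ∃ C : ℝ, ∀ x, ‖conv (S.rescaled 𝔡 j : 𝓢'(E d, ℂ)) g x‖ₑ ≤
      ENNReal.ofReal C * ENNReal.ofReal (((1 + ‖x‖) ^ N)⁻¹) := by
    intro g
    obtain ⟨C, hC, h⟩ := exists_decay
      (SchwartzMap.convolution (ContinuousLinearMap.mul ℂ ℂ) (S.rescaled 𝔡 j) g) N
    refine ⟨C, fun x => ?_⟩
    rw [conv_eq_convolution, ← ENNReal.ofReal_mul hC.le, ← ofReal_norm]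
    exact ENNReal.ofReal_le_ofReal (h x)
  refine ENNReal.add_lt_top.2 ⟨?_, ?_⟩
  · obtain ⟨C, hC⟩ := hdec S.Psi
    exact lpNorm_lt_top_of_decay hp hN ENNReal.ofReal_ne_top hC
  · choose C hC using fun s : ShearIndex d => hdec (dilate (matBA s)⁻¹ (tilde (S.psi s.1)))
    -- For a scale `k > J`, the inequality `k < 4^k` gives `4^k / 16 > d * 4^j`, so the two
    -- frequency supports are disjoint.
    obtain ⟨J, hJ⟩ := exists_nat_gt ((d : ℝ) * 4 ^ j * 16)
    have hfin : {s : ShearIndex d | s.2.1 ≤ J}.Finite := by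
      have : {s : ShearIndex d | s.2.1 ≤ J} = ⋃ 𝔢 : Fin d, ⋃ k : Fin (J + 1), Set.range
          fun l : {i : Fin d // i ≠ 𝔢} → Finset.Icc (-2 ^ (k : ℕ) : ℤ) (2 ^ (k : ℕ)) =>
            (⟨𝔢, (k : ℕ), l⟩ : ShearIndex d) := by
        ext ⟨𝔢, k, l⟩
        simp only [Set.mem_ofPred_eq, Set.mem_iUnion, Set.mem_range]
        constructor
        · intro hk
          exact ⟨𝔢, ⟨k, Nat.lt_succ_of_le hk⟩, l, rfl⟩
        · rintro ⟨𝔣, m, l', h⟩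
          have h1 := congrArg (fun s : ShearIndex d => s.2.1) h
          simp only at h1
          omega
      rw [this]
      exact Set.finite_iUnion fun _ => Set.finite_iUnion fun _ => Set.finite_range _
    have hzero : ∀ s ∉ hfin.toFinset, ∀ x, conv (S.rescaled 𝔡 j : 𝓢'(E d, ℂ))
        (dilate (matBA s)⁻¹ (tilde (S.psi s.1))) x = 0 := by
      intro s hs
      refine conv_eq_zero fun ξ => ?_
      by_contra! hξ
      have h1 := (S.of_fourier_rescaled_ne_zero hξ.1).2
      have h2 := S.of_fourier_dilate_tilde_ne_zero hξ.2
      simp only [Set.Finite.mem_toFinset, Set.mem_ofPred_eq, not_le] at hs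
      have h3 : (s.2.1 : ℝ) < 4 ^ s.2.1 := by exact_mod_cast Nat.lt_pow_self (by norm_num)
      have h4 : (J : ℝ) < s.2.1 := by exact_mod_cast hs
      linarith
    set T := hfin.toFinset
    set a : ShearIndex d → ℝ≥0∞ := fun s =>
      ENNReal.ofReal (cellVol d s.2.1 ^ (-α)) * ENNReal.ofReal (C s)
    have ha : ∀ s, a s ≠ ∞ := fun s =>
      ENNReal.mul_ne_top ENNReal.ofReal_ne_top ENNReal.ofReal_ne_top
    refine lpNorm_lt_top_of_decay hp hN
      (C := (T.card : ℝ≥0∞) ^ (1 / q.toReal) * ∑ s ∈ T, a s) ?_ fun x => ?_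
    · exact ENNReal.mul_ne_top (ENNReal.rpow_ne_top_of_nonneg (by positivity)
        (ENNReal.natCast_ne_top _)) (ENNReal.sum_ne_top.2 fun s _ => ha s)
    · rw [mul_assoc]
      refine lq_le_of_finset hq T (fun s hs => by rw [hzero s hs x]; simp) fun s hs => ?_
      calc ENNReal.ofReal (cellVol d s.2.1 ^ (-α)) * ‖conv (S.rescaled 𝔡 j : 𝓢'(E d, ℂ))
            (dilate (matBA s)⁻¹ (tilde (S.psi s.1))) x‖ₑ
          ≤ a s * ENNReal.ofReal (((1 + ‖x‖) ^ N)⁻¹) := by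
            rw [mul_assoc]
            gcongr
            exact hC s x
        _ ≤ _ := by
            gcongr
            exact Finset.single_le_sum (f := a) (fun _ _ => zero_le) hs

/-- All blocks but `(𝔡, j, 0)` are dropped. The weight `|Q_j|^{-α}` contributes `(d+1)α` to the
exponent, and the Jacobian of `A^j` in `L^p` contributes `-(d+1)/p`. -/
theorem ShearletSystem.exists_le_normF_rescaled (S : ShearletSystem d) (𝔡 : Fin d) (α : ℝ)
    {p : ℝ} {q : ℝ≥0∞} (hp : 0 < p) (hq : 0 < q) :
    ∃ G : ℝ≥0∞, 0 < G ∧ ∀ j : ℕ, ENNReal.ofReal ((2 : ℝ) ^ (j * ((d + 1) * α - (d + 1) / p))) * G ≤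
      S.normF α p q (S.rescaled 𝔡 j : 𝓢'(E d, ℂ)) := by
  refine ⟨lpNorm p fun x => ‖conv (S.psi 𝔡 : 𝓢'(E d, ℂ)) (tilde (S.psi 𝔡)) x‖ₑ, ?_, fun j => ?_⟩
  · refine lpNorm_pos hp ?_ (conv_tilde_self_ne_zero (S.psi_ne_zero 𝔡))
    simp only [funext (conv_eq_convolution _ _)]
    exact SchwartzMap.continuous _
  · refine le_trans ?_ (self_le_add_left _ _)
    refine le_trans ?_ (lpNorm_mono hp fun x => le_lq hq _ (zeroShear 𝔡 j))
    rw [lpNorm_const_mul hp ENNReal.ofReal_ne_top]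
    change _ ≤ ENNReal.ofReal (cellVol d j ^ (-α)) * lpNorm p fun x =>
      ‖conv (S.rescaled 𝔡 j : 𝓢'(E d, ℂ))
        (dilate (matBA (zeroShear 𝔡 j))⁻¹ (tilde (S.psi 𝔡))) x‖ₑ
    simp only [matBA_zeroShear, ShearletSystem.rescaled, conv_comp_dilate]
    rw [lpNorm_comp_glEquiv hp (matA 𝔡 ^ j)
      fun x => ‖conv (S.psi 𝔡 : 𝓢'(E d, ℂ)) (tilde (S.psi 𝔡)) x‖ₑ, abs_det_matA_pow_rpow,
      ← mul_assoc, ← ENNReal.ofReal_mul (Real.rpow_nonneg (by unfold cellVol; positivity) _),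
      cellVol, ← Real.rpow_mul (by norm_num), ← Real.rpow_add (by norm_num)]
    refine le_of_eq ?_
    congr 3
    ring

theorem DyadicSystem.exists_normF_rescaled_le (D : DyadicSystem d) (S : ShearletSystem d)
    (𝔡 : Fin d) (α : ℝ) {p : ℝ} {q : ℝ≥0∞} (hp : 0 < p) (hq : 0 < q) :
    ∃ K : ℝ≥0∞, K ≠ ∞ ∧ ∀ j : ℕ, 3 ≤ j → D.normF α p q (S.rescaled 𝔡 j : 𝓢'(E d, ℂ)) ≤
      ENNReal.ofReal ((2 : ℝ) ^ (j * (2 * α - (d + 1) / p))) * K := by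
  obtain ⟨N, hN⟩ := exists_nat_gt ((d : ℝ) / p)
  rw [div_lt_iff₀ hp] at hN
  -- The relevant `ν` satisfy `ν ≥ 2j - 5`, so `2^{-ν} A^j` has norm at most `4^j / 2^ν ≤ 2^5`.
  obtain ⟨K, hK, hdec⟩ := exists_integral_decay D.phi (S.psi 𝔡) N (R := 32) (by norm_num)
  set W := lpNorm p fun x : E d => ENNReal.ofReal (((1 + ‖x‖) ^ N)⁻¹)
  set n := (((d + 7 : ℕ) : ℝ≥0∞)) ^ (1 / q.toReal)
  -- Replacing `2^{να}` by `2^{2jα}` costs at most `2^{(d+5)|α|}`, because `|ν - 2j| ≤ d + 5`; `n`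
  -- accounts for the at most `d + 7` active values of `ν`.
  refine ⟨ENNReal.ofReal (2 ^ ((d + 5) * |α|) * K) * n * W, ?_, fun j hj => ?_⟩
  · exact ENNReal.mul_ne_top (ENNReal.mul_ne_top ENNReal.ofReal_ne_top
      (ENNReal.rpow_ne_top_of_nonneg (by positivity) (ENNReal.natCast_ne_top _)))
      (lpNorm_decay_lt_top hp hN).ne
  have h42 : (4 : ℝ) ^ j = 2 ^ (2 * j) := by rw [pow_mul]; norm_num
  -- For `j ≥ 3` the frequencies satisfy `|ξ| ≥ 4^j / 16 ≥ 4`, outside the support of `Φ̂`.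
  have hlow : ∀ x, conv (S.rescaled 𝔡 j : 𝓢'(E d, ℂ)) D.Phi x = 0 := by
    refine conv_eq_zero fun ξ => ?_
    by_contra! hξ
    have h1 := (S.of_fourier_rescaled_ne_zero hξ.1).1
    have h2 : ‖ξ‖ ≤ 2 := D.supp_Phi (subset_tsupport _ hξ.2)
    have h3 : (4 : ℝ) ^ 3 ≤ 4 ^ j := pow_le_pow_right₀ (by norm_num) hj
    linarith
  -- The lower end comes from `4^j / 16 ≤ 2 * 2^ν`, the upper from `2^ν / 2 ≤ d * 4^j` and `d ≤
  -- 2^d`. As `j ≥ 3`, the natural subtraction does not truncate.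
  set T := Finset.Icc (2 * j - 5) (2 * j + d + 1)
  have hcard : T.card ≤ d + 7 := by
    rw [Nat.card_Icc]
    omega
  have hzero : ∀ ν ∉ T, ∀ x, conv (S.rescaled 𝔡 j : 𝓢'(E d, ℂ)) (dyadicDilate ν D.phi) x = 0 := by
    intro ν hν
    refine conv_eq_zero fun ξ => ?_
    by_contra! hξ
    obtain ⟨h1, h2⟩ := S.of_fourier_rescaled_ne_zero hξ.1
    obtain ⟨h3, h4⟩ := D.of_fourier_dyadicDilate_ne_zero hξ.2
    rw [h42] at h1 h2
    refine hν (Finset.mem_Icc.2 ⟨?_, ?_⟩)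
    · have h5 : (2 : ℝ) ^ (2 * j) ≤ 2 ^ (ν + 5) := by
        rw [pow_add]; linarith
      have := (pow_le_pow_iff_right₀ (by norm_num : (1 : ℝ) < 2)).1 h5
      omega
    · have hd : (d : ℝ) ≤ 2 ^ d := by exact_mod_cast (Nat.lt_two_pow_self).le
      have h5 : (2 : ℝ) ^ ν ≤ 2 ^ (2 * j + d + 1) := by
        rw [pow_add, pow_add]
        have : (d : ℝ) * 2 ^ (2 * j) ≤ 2 ^ d * 2 ^ (2 * j) := by gcongr
        linarith
      exact (pow_le_pow_iff_right₀ (by norm_num : (1 : ℝ) < 2)).1 h5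
  have hterm : ∀ ν ∈ T, ∀ x, ENNReal.ofReal ((2 : ℝ) ^ ((ν : ℝ) * α)) *
      ‖conv (S.rescaled 𝔡 j : 𝓢'(E d, ℂ)) (dyadicDilate ν D.phi) x‖ₑ ≤
        ENNReal.ofReal (2 ^ ((j : ℝ) * (2 * α))) * ENNReal.ofReal (2 ^ ((d + 5) * |α|) * K) *
          ENNReal.ofReal (((1 + ‖glEquiv (matA 𝔡 ^ j) x‖) ^ N)⁻¹) := by
    intro ν hν x
    rw [Finset.mem_Icc] at hν
    have h1 : (2 : ℝ) ^ ((ν : ℝ) * α) ≤ 2 ^ ((j : ℝ) * (2 * α)) * 2 ^ ((d + 5) * |α|) := by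
      rw [← Real.rpow_add (by norm_num)]
      refine Real.rpow_le_rpow_of_exponent_le (by norm_num) ?_
      have h2 : |(ν : ℝ) - 2 * j| ≤ d + 5 := by
        have h3 : 2 * (j : ℝ) ≤ ν + 5 := by exact_mod_cast (by omega : 2 * j ≤ ν + 5)
        have h4 : (ν : ℝ) ≤ 2 * j + d + 1 := by exact_mod_cast hν.2
        rw [abs_le]
        constructor <;> linarith [(Nat.cast_nonneg d : (0 : ℝ) ≤ d)]
      have h5 : ((ν : ℝ) - 2 * j) * α ≤ (d + 5) * |α| :=
        (le_abs_self _).trans (by rw [abs_mul]; gcongr)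
      linarith
    have h2 : ‖conv (S.rescaled 𝔡 j : 𝓢'(E d, ℂ)) (dyadicDilate ν D.phi) x‖ ≤
        K * ((1 + ‖glEquiv (matA 𝔡 ^ j) x‖) ^ N)⁻¹ := by
      rw [ShearletSystem.rescaled, conv_comp_dyadicDilate]
      refine hdec (fun u => ((2 : ℝ) ^ ν)⁻¹ • glEquiv (matA 𝔡 ^ j) u) (fun u => ?_) _
      rw [norm_smul, norm_inv, norm_pow, Real.norm_ofNat, ← div_eq_inv_mul,
        div_le_iff₀ (by positivity)]
      have h3 : (4 : ℝ) ^ j ≤ 32 * 2 ^ ν := by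
        rw [h42, show (32 : ℝ) = 2 ^ 5 by norm_num, ← pow_add]
        exact pow_le_pow_right₀ (by norm_num) (by omega)
      calc ‖glEquiv (matA 𝔡 ^ j) u‖ ≤ 4 ^ j * ‖u‖ := norm_glEquiv_matA_pow_le 𝔡 j u
        _ ≤ 32 * 2 ^ ν * ‖u‖ := by gcongr
        _ = _ := by ring
    rw [← ofReal_norm, ← ENNReal.ofReal_mul (by positivity), ← ENNReal.ofReal_mul (by positivity),
      ← ENNReal.ofReal_mul (by positivity)]
    refine ENNReal.ofReal_le_ofReal ?_
    calc _ ≤ (2 ^ ((j : ℝ) * (2 * α)) * 2 ^ ((d + 5) * |α|)) *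
          (K * ((1 + ‖glEquiv (matA 𝔡 ^ j) x‖) ^ N)⁻¹) :=
          mul_le_mul h1 h2 (norm_nonneg _) (by positivity)
      _ = _ := by ring
  unfold DyadicSystem.normF
  simp only [hlow, enorm_zero, lpNorm_zero hp, zero_add]
  refine (lpNorm_mono hp fun x => (lq_le_of_finset hq T
    (fun ν hν => by rw [hzero ν hν x]; simp) fun ν hν => hterm ν hν x).trans
    (mul_le_mul_left (ENNReal.rpow_le_rpow (Nat.cast_le.2 hcard) (by positivity)) _)).trans ?_
  rw [lpNorm_const_mul hp (ENNReal.rpow_ne_top_of_nonneg (by positivity)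
      (ENNReal.natCast_ne_top _)),
    lpNorm_const_mul hp (ENNReal.mul_ne_top ENNReal.ofReal_ne_top ENNReal.ofReal_ne_top),
    lpNorm_comp_glEquiv hp (matA 𝔡 ^ j) fun x => ENNReal.ofReal (((1 + ‖x‖) ^ N)⁻¹),
    abs_det_matA_pow_rpow]
  have hsplit : ENNReal.ofReal ((2 : ℝ) ^ (j * (2 * α - (d + 1) / p))) =
      ENNReal.ofReal (2 ^ ((j : ℝ) * (2 * α))) *
        ENNReal.ofReal (2 ^ ((j : ℝ) * -((d + 1) / p))) := by
    rw [← ENNReal.ofReal_mul (by positivity), ← Real.rpow_add (by norm_num), ← mul_add,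
      ← sub_eq_add_neg]
  rw [hsplit]
  generalize ENNReal.ofReal (2 ^ ((j : ℝ) * (2 * α))) = a
  generalize ENNReal.ofReal (2 ^ ((j : ℝ) * -((d + 1) / p))) = b
  generalize ENNReal.ofReal (2 ^ ((d + 5) * |α|) * K) = c
  change n * (a * c * (b * W)) ≤ a * b * (c * n * W)
  exact le_of_eq (by ring)

end

end ShearTL

/-! ### Normalisation and comparison of growth rates -/

theorem mainTheorem11 (d : ℕ) (hd : 2 ≤ d) (S : ShearTL.ShearletSystem d)
    (α₁ α₂ p₁ p₂ : ℝ) (q₁ q₂ : ℝ≥0∞)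
    (hp₁ : 0 < p₁) (hp₂ : 0 < p₂) (hq₁ : 0 < q₁) (hq₂ : 0 < q₂)
    (h : 2 * (α₁ + d) < (d + 1) * (α₂ - 1 / p₂ + 1) + d / p₁) :
    ∃ f : ℕ → 𝓢(ShearTL.E d, ℂ),
      (∀ j, ∃ c : ℂ, f j = c • S.shearlet (ShearTL.zeroShear ⟨0, by omega⟩ j) 0) ∧
      (∃ c C : ℝ, 0 < c ∧ ∀ j,
        ENNReal.ofReal c ≤ S.normF α₂ p₂ q₂ (f j) ∧
        S.normF α₂ p₂ q₂ (f j) ≤ ENNReal.ofReal C) ∧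
      ∀ D : ShearTL.DyadicSystem d,
        Tendsto (fun j => D.normF α₁ p₁ q₁ (f j)) atTop (𝓝 0) := by
  set 𝔡 : Fin d := ⟨0, by omega⟩
  obtain ⟨G, hG, hlow⟩ := S.exists_le_normF_rescaled 𝔡 α₂ hp₂ hq₂
  set A : ℕ → ℝ≥0∞ := fun j => S.normF α₂ p₂ q₂ (S.rescaled 𝔡 j : 𝓢'(ShearTL.E d, ℂ))
  have hAtop : ∀ j, A j ≠ ∞ := fun j => (S.normF_rescaled_lt_top 𝔡 j α₂ hp₂ hq₂).ne
  have hpow : ∀ t : ℝ, ENNReal.ofReal ((2 : ℝ) ^ t) ≠ 0 := fun t =>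
    (ENNReal.ofReal_pos.2 (by positivity)).ne'
  have hApos : ∀ j, A j ≠ 0 := fun j =>
    ((ENNReal.mul_pos (hpow _) hG.ne').trans_le (hlow j)).ne'
  have henorm : ∀ j, ‖(((A j).toReal⁻¹ : ℝ) : ℂ)‖ₑ = (A j)⁻¹ := by
    intro j
    rw [← ofReal_norm, Complex.norm_real, Real.norm_of_nonneg (by positivity),
      ENNReal.ofReal_inv_of_pos (ENNReal.toReal_pos (hApos j) (hAtop j)),
      ENNReal.ofReal_toReal (hAtop j)]
  have hone : ∀ j, S.normF α₂ p₂ q₂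
      (((((A j).toReal⁻¹ : ℝ) : ℂ) • S.rescaled 𝔡 j : 𝓢(ShearTL.E d, ℂ)) :
        𝓢'(ShearTL.E d, ℂ)) = 1 := by
    intro j
    rw [S.normF_smul α₂ hp₂ hq₂, henorm]
    exact ENNReal.inv_mul_cancel (hApos j) (hAtop j)
  -- Dividing by `A j` makes the shear quasi-norm exactly `1`, so both constants can be `1`.
  refine ⟨fun j => (((A j).toReal⁻¹ : ℝ) : ℂ) • S.rescaled 𝔡 j, fun j => ?_,
    ⟨1, 1, one_pos, fun j => by rw [hone]; simp⟩, fun D => ?_⟩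
  · obtain ⟨c, hc, e⟩ := S.shearlet_zeroShear 𝔡 j
    exact ⟨(((A j).toReal⁻¹ : ℝ) : ℂ) * c⁻¹, by
      rw [e, smul_smul, mul_assoc, inv_mul_cancel₀ hc, mul_one]⟩
  · obtain ⟨K, hK, hup⟩ := D.exists_normF_rescaled_le S 𝔡 α₁ hp₁ hq₁
    set b : ℝ := (2 * α₁ - (d + 1) / p₁) - ((d + 1) * α₂ - (d + 1) / p₂) with hb
    -- Expanding the hypothesis gives `b < 1 - d - 1 / p₁`.
    have hb0 : b < 0 := by
      have h1 : 0 < 1 / p₁ := by positivity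
      have h2 : (2 : ℝ) ≤ d := by exact_mod_cast hd
      have h3 : (d + 1 : ℝ) / p₁ = d / p₁ + 1 / p₁ := add_div _ _ _
      have h4 : (d + 1 : ℝ) * (α₂ - 1 / p₂ + 1) = (d + 1) * α₂ - (d + 1) / p₂ + (d + 1) := by ring
      rw [hb, h3]
      linarith
    have hr : Tendsto (fun j : ℕ => ENNReal.ofReal ((2 : ℝ) ^ ((j : ℝ) * b)) * (G⁻¹ * K)) atTop
        (𝓝 0) := by
      have h1 : Tendsto (fun j : ℕ => ENNReal.ofReal ((2 : ℝ) ^ ((j : ℝ) * b))) atTop (𝓝 0) := by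
        rw [← ENNReal.ofReal_zero]
        refine ENNReal.tendsto_ofReal ?_
        have h2 : ∀ j : ℕ, (2 : ℝ) ^ ((j : ℝ) * b) = ((2 : ℝ) ^ b) ^ j := by
          intro j
          rw [mul_comm, Real.rpow_mul (by norm_num), Real.rpow_natCast]
        simp only [h2]
        exact tendsto_pow_atTop_nhds_zero_of_lt_one (by positivity)
          (Real.rpow_lt_one_of_one_lt_of_neg (by norm_num) hb0)
      have h2 := ENNReal.Tendsto.mul_const h1
        (Or.inr (ENNReal.mul_ne_top (ENNReal.inv_ne_top.2 hG.ne') hK))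
      rwa [zero_mul] at h2
    refine tendsto_of_tendsto_of_tendsto_of_le_of_le' tendsto_const_nhds hr
      (Eventually.of_forall fun _ => zero_le) ?_
    filter_upwards [eventually_ge_atTop 3] with j hj
    rw [D.normF_smul α₁ hp₁ hq₁, henorm]
    calc (A j)⁻¹ * D.normF α₁ p₁ q₁ (S.rescaled 𝔡 j : 𝓢'(ShearTL.E d, ℂ))
        ≤ (ENNReal.ofReal ((2 : ℝ) ^ (j * ((d + 1) * α₂ - (d + 1) / p₂))) * G)⁻¹ *
            (ENNReal.ofReal ((2 : ℝ) ^ (j * (2 * α₁ - (d + 1) / p₁))) * K) :=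
          mul_le_mul' (ENNReal.inv_le_inv.2 (hlow j)) (hup j hj)
      _ = ENNReal.ofReal ((2 : ℝ) ^ ((j : ℝ) * b)) * (G⁻¹ * K) := by
          rw [ENNReal.mul_inv (Or.inl (hpow _)) (Or.inl ENNReal.ofReal_ne_top),
            ← ENNReal.ofReal_inv_of_pos (by positivity), ← Real.rpow_neg (by norm_num),
            mul_mul_mul_comm, ← ENNReal.ofReal_mul (by positivity),
            ← Real.rpow_add (by norm_num), hb]
          congr 3
          ring
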